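/- Let $T>0$, let $n\ge 1$ be an integer, and consider the uniform mesh of $(0,T)$ with mesh size $h=T/n$ and nodes $t_i=ih$, $i=0,\dots,n$. Let $S_h^0(0,T)\subset L^2(0,T)$ be the space of functions that are constant on each $(t_{i-1},t_i)$, and let $Q_h\colon L^2(0,T)\to S_h^0(0,T)$ be the $L^2(0,T)$-orthogonal projection. Let $\mathcal H_T^{-1}\colon L^2(0,T)\to L^2(0,T)$ be the inverse of the modified Hilbert transformation, given by $$(\mathcal H_T^{-1}w)(t)=\sum_{k=0}^\infty \overline w_k\,\sin\Big(\big(\tfrac{\pi}{2}+k\pi\big)\tfrac{t}{T}\Big),\qquad \overline w_k=\frac2T\int_0^T w(t)\cos\Big(\big(\tfrac{\pi}{2}+k\pi\big)\tfrac{t}{T}\Big)\,dt ,$$ with convergence in $L^2(0,T)$. **Lemma.** Let $u\in H^2(0,T)$, with weak derivatives $\partial_t u,\partial_{tt}u\in L^2(0,T)$. Then $\partial_t u$ has a continuous representative on $[0,T]$, through which its point values are defined. Let $$u^1(t)=\Big(t-\tfrac12(t_i+t_{i-1})\Big)\,\partial_t u(t_{i-1})\quad\text{for } t\in(t_{i-1},t_i),\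 i=1,\dots,n,$$ and $w_h^1:=Q_h\mathcal H_T^{-1}u^1\in S_h^0(0,T)$. Then, for every $n\ge1$, $$\|w_h^1\|_{L^2(0,T)}^2\le \frac{\pi}{96}\,h^4\,\|\partial_{tt}u\|_{L^2(0,T)}^2+\frac{\pi}{48}\,h^3\,[\partial_t u(0)]^2 .$$ In particular, if $\partial_t u(0)=0$, then, for every $n\ge1$, $$\|w_h^1\|_{L^2(0,T)}^2\le \frac{\pi}{96}\,h^4\,\|\partial_{tt}u\|_{L^2(0,T)}^2 ,$$ and hence $\|w_h^1\|_{L^2(0,T)}=O(h^2)$ as $n\to\infty$ (that is, as $h=T/n\to0$). -/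

import Mathlib

open MeasureTheory Set Filter Asymptotics
open scoped ContDiff

noncomputable section

/-- Lebesgue measure on the interval `(0,T)`. -/
abbrev intervalMeasure (T : ℝ) : Measure ℝ := volume.restrict (Ioo 0 T)

/-- The real Hilbert space `L²(0,T)`. -/
abbrev L2Space (T : ℝ) : Type := Lp ℝ 2 (intervalMeasure T)

/-- A continuous function on `ℝ` restricted to `(0,T)` belongs to `L²(0,T)`. -/
theorem memLp_of_continuous (T : ℝ) {f : ℝ → ℝ} (hf : Continuous f) :
    MemLp f 2 (intervalMeasure T) := by
  obtain ⟨C, hC⟩ := (isCompact_Icc (a := (0 : ℝ)) (b := T)).exists_bound_of_continuousOn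
    hf.continuousOn
  refine MemLp.of_bound hf.aestronglyMeasurable C ?_
  exact (ae_restrict_iff' measurableSet_Ioo).2
    (Eventually.of_forall fun x hx => hC x (Ioo_subset_Icc_self hx))

/-! ### The inverse of the modified Hilbert transformation -/

/-- The frequency `(π/2 + kπ)/T`. -/
def freq (T : ℝ) (k : ℕ) : ℝ := (Real.pi / 2 + k * Real.pi) / T

/-- The function `t ↦ sin ((π/2 + kπ) t/T)` as an element of `L²(0,T)`. -/
def sinMode (T : ℝ) (k : ℕ) : L2Space T :=
  (memLp_of_continuous T (f := fun t => Real.sin (freq T k * t)) (by fun_prop)).toLp _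

/-- The function `t ↦ cos ((π/2 + kπ) t/T)` as an element of `L²(0,T)`. -/
def cosMode (T : ℝ) (k : ℕ) : L2Space T :=
  (memLp_of_continuous T (f := fun t => Real.cos (freq T k * t)) (by fun_prop)).toLp _

/-- The cosine Fourier coefficient
`w̄ₖ = (2/T) ∫₀ᵀ w(t) cos ((π/2 + kπ) t/T) dt` of `w ∈ L²(0,T)`. -/
def cosCoeff (T : ℝ) (w : L2Space T) (k : ℕ) : ℝ :=
  2 / T * ∫ t in Ioo 0 T, w t * Real.cos (freq T k * t)

/-- The inverse modified Hilbert transformation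
`(𝓗_T⁻¹ w)(t) = ∑ₖ w̄ₖ sin ((π/2 + kπ) t/T)`, the series being taken in `L²(0,T)`
(it converges there, see `summable_invModHilbert`). -/
def invModHilbert (T : ℝ) (w : L2Space T) : L2Space T :=
  ∑' k : ℕ, cosCoeff T w k • sinMode T k

/-! #### Convergence of the defining series -/

theorem integral_cos_int_mul (T : ℝ) (hT : 0 < T) (m : ℤ) :
    ∫ t in (0 : ℝ)..T, Real.cos (m * Real.pi / T * t) = if m = 0 then T else 0 := by
  split_ifs with hm
  · simp [hm]
  have hc : (m : ℝ) * Real.pi / T ≠ 0 :=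
    div_ne_zero (mul_ne_zero (by exact_mod_cast hm) Real.pi_ne_zero) hT.ne'
  rw [intervalIntegral.integral_comp_mul_left (fun x => Real.cos x) hc, integral_cos,
    div_mul_cancel₀ _ hT.ne', mul_zero, Real.sin_zero, Real.sin_int_mul_pi]
  simp

theorem inner_toLp_eq (T : ℝ) (hT : 0 < T) {f g : ℝ → ℝ} (hf : Continuous f)
    (hg : Continuous g) :
    inner ℝ ((memLp_of_continuous T hf).toLp f) ((memLp_of_continuous T hg).toLp g) =
      ∫ t in (0 : ℝ)..T, f t * g t := by
  rw [L2.inner_def, intervalIntegral.integral_of_le hT.le, integral_Ioc_eq_integral_Ioo]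
  refine integral_congr_ae ?_
  filter_upwards [(memLp_of_continuous T hf).coeFn_toLp, (memLp_of_continuous T hg).coeFn_toLp]
    with t h1 h2
  rw [h1, h2]
  simp [mul_comm]

theorem integral_modes (T : ℝ) (hT : 0 < T) (j k : ℕ) (ε : ℝ) :
    ∫ t in (0 : ℝ)..T, (Real.cos (((j - k : ℤ) : ℝ) * Real.pi / T * t) +
      ε * Real.cos (((j + k + 1 : ℤ) : ℝ) * Real.pi / T * t)) / 2 =
      if j = k then T / 2 else 0 := by
  have h1 : ((j : ℤ) + k + 1) ≠ 0 := by omega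
  rw [intervalIntegral.integral_div, intervalIntegral.integral_add
    (Continuous.intervalIntegrable (by fun_prop) _ _)
    (Continuous.intervalIntegrable (by fun_prop) _ _), intervalIntegral.integral_const_mul,
    integral_cos_int_mul T hT, integral_cos_int_mul T hT, if_neg h1]
  by_cases h : j = k
  · simp [h]
  · have : ((j : ℤ) - k) ≠ 0 := by omega
    simp [h, this]

theorem inner_sinMode (T : ℝ) (hT : 0 < T) (j k : ℕ) :
    inner ℝ (sinMode T j) (sinMode T k) = if j = k then T / 2 else 0 := by
  rw [sinMode, sinMode, inner_toLp_eq T hT (by fun_prop) (by fun_prop),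
    ← integral_modes T hT j k (-1)]
  congr 1
  ext t
  have e1 : ((j - k : ℤ) : ℝ) * Real.pi / T * t = freq T j * t - freq T k * t := by
    simp only [freq]; push_cast; ring
  have e2 : ((j + k + 1 : ℤ) : ℝ) * Real.pi / T * t = freq T j * t + freq T k * t := by
    simp only [freq]; push_cast; ring
  rw [e1, e2, Real.cos_sub, Real.cos_add]
  ring

theorem inner_cosMode (T : ℝ) (hT : 0 < T) (j k : ℕ) :
    inner ℝ (cosMode T j) (cosMode T k) = if j = k then T / 2 else 0 := by
  rw [cosMode, cosMode, inner_toLp_eq T hT (by fun_prop) (by fun_prop),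
    ← integral_modes T hT j k 1]
  congr 1
  ext t
  have e1 : ((j - k : ℤ) : ℝ) * Real.pi / T * t = freq T j * t - freq T k * t := by
    simp only [freq]; push_cast; ring
  have e2 : ((j + k + 1 : ℤ) : ℝ) * Real.pi / T * t = freq T j * t + freq T k * t := by
    simp only [freq]; push_cast; ring
  rw [e1, e2, Real.cos_sub, Real.cos_add]
  ring

theorem orthonormal_of_inner {E : Type*} [NormedAddCommGroup E] [InnerProductSpace ℝ E]
    {T : ℝ} (hT : 0 < T) {v : ℕ → E}
    (hv : ∀ j k, inner ℝ (v j) (v k) = if j = k then T / 2 else 0) :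
    Orthonormal ℝ fun k => Real.sqrt (2 / T) • v k := by
  rw [orthonormal_iff_ite]
  intro j k
  rw [real_inner_smul_left, real_inner_smul_right, hv, ← mul_assoc,
    Real.mul_self_sqrt (by positivity)]
  split_ifs
  · field_simp
  · simp

theorem cosCoeff_eq_inner (T : ℝ) (w : L2Space T) (k : ℕ) :
    cosCoeff T w k = 2 / T * inner ℝ (cosMode T k) w := by
  rw [cosCoeff, L2.inner_def]
  congr 1
  refine integral_congr_ae ?_
  filter_upwards [(memLp_of_continuous T
    (f := fun t => Real.cos (freq T k * t)) (by fun_prop)).coeFn_toLp] with t h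
  rw [cosMode, h]
  simp

/-- The series defining `invModHilbert T w` converges in `L²(0,T)` for every `w`. -/
theorem summable_invModHilbert (T : ℝ) (hT : 0 < T) (w : L2Space T) :
    Summable fun k => cosCoeff T w k • sinMode T k := by
  have hs := orthonormal_of_inner hT (inner_sinMode T hT)
  have hc := (orthonormal_of_inner hT (inner_cosMode T hT)).inner_products_summable (x := w)
  have hr : Real.sqrt (2 / T) * Real.sqrt (2 / T) = 2 / T :=
    Real.mul_self_sqrt (by positivity)
  have key := (hs.orthogonalFamily.summable_iff_norm_sq_summable
    (fun k => inner ℝ (Real.sqrt (2 / T) • cosMode T k) w)).2 hc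
  refine key.congr fun k => ?_
  rw [LinearIsometry.toSpanSingleton_apply, cosCoeff_eq_inner, smul_smul,
    real_inner_smul_left]
  congr 1
  linear_combination (inner ℝ (cosMode T k) w) * hr

/-! ### Piecewise constant functions and the `L²` projection -/

/-- The mesh size `h = T/n`. -/
def meshSize (T : ℝ) (n : ℕ) : ℝ := T / n

/-- The node `tᵢ = i h`. -/
def node (T : ℝ) (n i : ℕ) : ℝ := i * meshSize T n

/-- The `i`-th element `(tᵢ, tᵢ₊₁)` of the mesh, `i = 0, …, n - 1`. -/
def element (T : ℝ) (n i : ℕ) : Set ℝ := Ioo (node T n i) (node T n (i + 1))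

/-- The indicator function of the `i`-th element, in `L²(0,T)`. -/
def elementIndicator (T : ℝ) (n i : ℕ) : L2Space T :=
  indicatorConstLp 2 (s := element T n i) measurableSet_Ioo (measure_ne_top _ _) (1 : ℝ)

/-- The space `S_h⁰(0,T)` of piecewise constant functions on the uniform mesh with `n`
elements, as a subspace of `L²(0,T)`. -/
def piecewiseConst (T : ℝ) (n : ℕ) : Submodule ℝ (L2Space T) :=
  Submodule.span ℝ (range fun i : Fin n => elementIndicator T n i)

instance piecewiseConst_finiteDimensional (T : ℝ) (n : ℕ) :
    FiniteDimensional ℝ (piecewiseConst T n) :=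
  FiniteDimensional.span_of_finite ℝ (finite_range _)

/-- The `L²` projection `Q_h` onto `S_h⁰(0,T)`. -/
def projConst (T : ℝ) (n : ℕ) (v : L2Space T) : L2Space T :=
  (piecewiseConst T n).starProjection v

/-! ### The Sobolev space `H²(0,T)` -/

/-- `g` is the weak derivative of `f` on `(0,T)`. -/
def HasWeakDeriv (T : ℝ) (f g : ℝ → ℝ) : Prop :=
  LocallyIntegrableOn f (Ioo 0 T) ∧ LocallyIntegrableOn g (Ioo 0 T) ∧
    ∀ φ : ℝ → ℝ, ContDiff ℝ ∞ φ → HasCompactSupport φ → tsupport φ ⊆ Ioo 0 T →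
      ∫ t in Ioo 0 T, f t * deriv φ t = -∫ t in Ioo 0 T, g t * φ t

/-- `u`, its first weak derivative `du` and its second weak derivative `ddu` are all in
`L²(0,T)`. -/
structure HasH2Derivs (T : ℝ) (u du ddu : ℝ → ℝ) : Prop where
  memLp : MemLp u 2 (intervalMeasure T)
  memLp_deriv : MemLp du 2 (intervalMeasure T)
  memLp_deriv2 : MemLp ddu 2 (intervalMeasure T)
  weakDeriv : HasWeakDeriv T u du
  weakDeriv2 : HasWeakDeriv T du ddu

/-- `u ∈ H²(0,T)`. -/
def MemH2 (T : ℝ) (u : ℝ → ℝ) : Prop := ∃ du ddu : ℝ → ℝ, HasH2Derivs T u du ddu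

/-- The `L²(0,T)` norm of a function in `L²(0,T)`. -/
def l2Norm (T : ℝ) (f : ℝ → ℝ) : ℝ := (eLpNorm f 2 (intervalMeasure T)).toReal

/-! ### The piecewise linear function `u¹` -/

/-- `u¹(t) = (t - (tᵢ + tᵢ₊₁)/2) u'(tᵢ)` for `t ∈ (tᵢ, tᵢ₊₁)`, `i = 0, …, n - 1`,
where `du` is `u'`. -/
def u1Fun (T : ℝ) (n : ℕ) (du : ℝ → ℝ) (t : ℝ) : ℝ :=
  ∑ i ∈ Finset.range n, (element T n i).indicator
    (fun s => (s - (node T n i + node T n (i + 1)) / 2) * du (node T n i)) t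

theorem memLp_u1Fun (T : ℝ) (n : ℕ) (du : ℝ → ℝ) :
    MemLp (u1Fun T n du) 2 (intervalMeasure T) := by
  refine memLp_finsetSum _ fun i _ => ?_
  exact (memLp_of_continuous T (f := fun s =>
    (s - (node T n i + node T n (i + 1)) / 2) * du (node T n i)) (by fun_prop)).indicator
      measurableSet_Ioo

/-- `u¹` as an element of `L²(0,T)`. -/
def u1Part (T : ℝ) (n : ℕ) (du : ℝ → ℝ) : L2Space T := (memLp_u1Fun T n du).toLp _

/-- `w_h¹ = Q_h 𝓗_T⁻¹ u¹`. -/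
def wh1 (T : ℝ) (n : ℕ) (du : ℝ → ℝ) : L2Space T :=
  projConst T n (invModHilbert T (u1Part T n du))

end

/-!
Why the estimate holds. Let `h` be the mesh size, `dᵢ = ∂ₜu(tᵢ)` and `θₖ = (2k+1)π/(4n)`, and
write `d̂ₖ = ∑ᵢ dᵢ sin ((2i+1)θₖ)` for the discrete sine transform. For a piecewise constant
`w = ∑ᵢ cᵢ 1ᵢ`, the defining series of `𝓗_T⁻¹` and elementary integrals over the elements give
(`hasSum_inner_invModHilbert`)
`⟨w, 𝓗_T⁻¹ u¹⟩ = -(h³/T) ∑ₖ d̂ₖ ĉₖ L(θₖ)`, with `L(x) = sin x (sin x - x cos x) / x³`.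

The sum runs over all `k ∈ ℕ`, but `d̂` and `ĉ` only see `n` frequencies: `π m ± θₖ` is an alias
of `θₖ`, and the product `d̂ₖ ĉₖ` is the same for all aliases. So the series is a sum over `k < n`
with `L` replaced by its periodization, and the decisive fact
(`sq_periodized_modeSymbol_le`) is that the periodization is at most `√(π/6) sin θ`. Its zero at
`θ = 0` expresses that `u¹` has mean zero on each element. By the Cauchy-Schwarz inequality
(`sq_sum_modeSymbol_le`) the square of the sum is at most `(π/6) ∑ ĉₖ² ∑ sin² θₖ d̂ₖ²`. The first
sum is a multiple of `‖w‖²`, by orthogonality of the sine vectors. In the second, summation by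
parts turns `2 sin θₖ d̂ₖ` into a cosine transform of increments of `d`, so that it equals
`(n/8) (2 d₀² + ∑ (dᵢ₊₁ - dᵢ)²)` (`sum_sin_sq_mul_sineTransform_sq`). With `w = w_h¹`, for which
`⟨w, 𝓗_T⁻¹ u¹⟩ = ‖w‖²`, this yields `norm_sq_wh1_le`.

Finally the increments satisfy `∑ (dᵢ₊₁ - dᵢ)² ≤ h ‖∂ₜₜu‖²`
(`HasH2Derivs.sum_sq_sub_le`), because by the lemma of du Bois-Reymond the continuous
representative of `∂ₜu` is a primitive of `∂ₜₜu`.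
-/

/-! ### Weak derivatives on an interval -/

/-- A smooth function supported in `(0,T)` with zero integral has a primitive which is again
smooth and supported in `(0,T)`. -/
theorem exists_primitive_of_integral_eq_zero {T : ℝ} (hT : 0 < T) {g : ℝ → ℝ}
    (hg : ContDiff ℝ ∞ g) (hgc : HasCompactSupport g) (hgs : tsupport g ⊆ Ioo 0 T)
    (hg0 : ∫ t in (0 : ℝ)..T, g t = 0) :
    ∃ φ : ℝ → ℝ, ContDiff ℝ ∞ φ ∧ HasCompactSupport φ ∧ tsupport φ ⊆ Ioo 0 T ∧
      deriv φ = g := by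
  obtain ⟨a, b, ha, hb, hab⟩ : ∃ a b : ℝ, 0 < a ∧ b < T ∧ tsupport g ⊆ Icc a b := by
    rcases (tsupport g).eq_empty_or_nonempty with he | hne
    -- Any reversed interval with ends in the right place serves for an empty support.
    · exact ⟨T, 0, hT, hT, by simp [he]⟩
    · exact ⟨sInf (tsupport g), sSup (tsupport g), (hgs (hgc.sInf_mem hne)).1,
        (hgs (hgc.sSup_mem hne)).2, fun x hx =>
          ⟨csInf_le hgc.bddBelow hx, le_csSup hgc.bddAbove hx⟩⟩
  have hgz : ∀ t, t ∉ Icc a b → g t = 0 := fun t ht =>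
    image_eq_zero_of_notMem_tsupport fun h => ht (hab h)
  have hd : ∀ t, HasDerivAt (fun x => ∫ s in (0 : ℝ)..x, g s) (g t) t := fun t =>
    hg.continuous.integral_hasStrictDerivAt 0 t |>.hasDerivAt
  have hderiv : deriv (fun x => ∫ s in (0 : ℝ)..x, g s) = g := funext fun t => (hd t).deriv
  have hsupp : tsupport (fun x => ∫ s in (0 : ℝ)..x, g s) ⊆ Icc a b := by
    refine closure_minimal (fun x hx => ?_) isClosed_Icc
    by_contra hxm
    refine hx ?_
    rcases not_and_or.1 hxm with h | h
    · refine intervalIntegral.integral_zero_ae (Eventually.of_forall fun t ht => hgz t ?_)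
      intro hab'
      rcases mem_uIoc.1 ht with ⟨_, h2⟩ | ⟨_, h2⟩
      · exact h (hab'.1.trans h2)
      · exact absurd (hab'.1.trans h2) (not_le.2 ha)
    · have : ∫ s in x..T, g s = 0 := by
        refine intervalIntegral.integral_zero_ae (Eventually.of_forall fun t ht => hgz t ?_)
        intro hab'
        rcases mem_uIoc.1 ht with ⟨h2, _⟩ | ⟨h2, _⟩
        · exact h (h2.le.trans hab'.2)
        · exact absurd (h2.trans_le hab'.2) (not_lt.2 hb.le)
      have h2 := intervalIntegral.integral_add_adjacent_intervals
        (hg.continuous.intervalIntegrable (μ := volume) 0 x)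
        (hg.continuous.intervalIntegrable x T)
      rw [this, hg0, add_zero] at h2
      exact h2
  refine ⟨_, ?_, ?_, ?_, hderiv⟩
  · rw [contDiff_infty_iff_deriv, hderiv]
    exact ⟨fun t => (hd t).differentiableAt, hg⟩
  · exact isCompact_Icc.of_isClosed_subset (isClosed_tsupport _) hsupp
  · exact hsupp.trans fun x hx => ⟨ha.trans_le hx.1, hx.2.trans_lt hb⟩

/-- The lemma of du Bois-Reymond: a function whose weak derivative vanishes is constant. -/
theorem ae_eq_const_of_integral_mul_deriv_eq_zero {T : ℝ} (hT : 0 < T) {f : ℝ → ℝ}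
    (hf : MemLp f 2 (intervalMeasure T))
    (h : ∀ φ : ℝ → ℝ, ContDiff ℝ ∞ φ → HasCompactSupport φ → tsupport φ ⊆ Ioo 0 T →
      ∫ t in Ioo 0 T, f t * deriv φ t = 0) :
    ∃ c : ℝ, f =ᵐ[intervalMeasure T] fun _ => c := by
  obtain ⟨η, hηs, hηc, hη, hηr, hη1⟩ := exists_contDiff_tsupport_subset (E := ℝ) (n := ⊤)
    (isOpen_Ioo.mem_nhds (show T / 2 ∈ Ioo 0 T by constructor <;> linarith))
  have hη0 : ∀ t, 0 ≤ η t := fun t => (hηr ⟨t, rfl⟩).1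
  have hI : 0 < ∫ t in (0 : ℝ)..T, η t := by
    refine intervalIntegral.integral_pos hT hη.continuous.continuousOn (fun t _ => hη0 t)
      ⟨T / 2, by constructor <;> linarith, by rw [hη1]; exact one_pos⟩
  have hint : ∀ {g : ℝ → ℝ}, Continuous g → Integrable (fun t => f t * g t)
      (intervalMeasure T) := fun hg => hf.integrable_mul (memLp_of_continuous T hg)
  set I := ∫ t in (0 : ℝ)..T, η t with hIdef
  refine ⟨(∫ t in Ioo 0 T, f t * η t) / I, ?_⟩
  set c := (∫ t in Ioo 0 T, f t * η t) / I with hc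
  have hf1 : IntegrableOn f (Ioo 0 T) := hf.integrable one_le_two
  have key := isOpen_Ioo.ae_eq_zero_of_integral_contDiff_smul_eq_zero (μ := volume)
    (U := Ioo 0 T) (f := fun t => f t - c)
    ((hf1.sub (integrable_const c)).locallyIntegrableOn) ?_
  · refine (ae_restrict_iff' measurableSet_Ioo).2 ?_
    filter_upwards [key] with t ht hm
    exact sub_eq_zero.1 (ht hm)
  intro g hg hgc hgs
  -- Subtracting a multiple of the fixed bump `η` makes the integral of `g` vanish.
  set J := ∫ t in (0 : ℝ)..T, g t with hJ
  have hg2 : ContDiff ℝ ∞ (fun t => g t - J / I * η t) := hg.sub (contDiff_const.mul hη)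
  have hts : tsupport (fun t => g t - J / I * η t) ⊆ tsupport g ∪ tsupport η := by
    refine closure_minimal (fun x hx => ?_) ((isClosed_tsupport _).union (isClosed_tsupport _))
    by_contra hxm
    rw [mem_union, not_or] at hxm
    exact hx (by simp [image_eq_zero_of_notMem_tsupport hxm.1,
      image_eq_zero_of_notMem_tsupport hxm.2])
  obtain ⟨φ, hφ, hφc, hφs, hφd⟩ := exists_primitive_of_integral_eq_zero hT hg2
    ((hgc.isCompact.union hηc.isCompact).of_isClosed_subset (isClosed_tsupport _) hts)
    (hts.trans (union_subset hgs hηs)) (by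
      rw [intervalIntegral.integral_sub (hg.continuous.intervalIntegrable _ _)
        ((hη.continuous.intervalIntegrable _ _).const_mul _),
        intervalIntegral.integral_const_mul, ← hJ, ← hIdef]
      field_simp
      ring)
  have h0 := h φ hφ hφc hφs
  have e1 : (∫ t in Ioo 0 T, f t * deriv φ t) =
      (∫ t in Ioo 0 T, f t * g t) - J / I * ∫ t in Ioo 0 T, f t * η t := by
    rw [hφd, ← integral_const_mul, ← integral_sub (hint hg.continuous)
      ((hint hη.continuous).const_mul _)]
    congr 1; ext t; ring
  have e2 : ∫ t in Ioo 0 T, g t = J := by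
    rw [hJ, intervalIntegral.integral_of_le hT.le, integral_Ioc_eq_integral_Ioo]
  have e3 : ∫ t, g t • (f t - c) = ∫ t in Ioo 0 T, g t • (f t - c) := by
    refine (setIntegral_eq_integral_of_forall_compl_eq_zero fun t ht => ?_).symm
    rw [image_eq_zero_of_notMem_tsupport fun h => ht (hgs h), zero_smul]
  have e4 : ∫ t in Ioo 0 T, g t • (f t - c) = (∫ t in Ioo 0 T, f t * g t) - c * J := by
    rw [← e2, ← integral_const_mul, ← integral_sub (hint hg.continuous)
      (((memLp_of_continuous T hg.continuous).integrable one_le_two).const_mul _)]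
    congr 1; ext t; simp only [smul_eq_mul]; ring
  rw [e3, e4, hc]
  rw [e1] at h0
  linear_combination h0

theorem intervalIntegrable_of_memLp {T : ℝ} (hT : 0 < T) {g : ℝ → ℝ}
    (hg : MemLp g 2 (intervalMeasure T)) : IntervalIntegrable g volume 0 T := by
  rw [intervalIntegrable_iff_integrableOn_Ioo_of_le hT.le]
  exact hg.integrable one_le_two

theorem continuousOn_primitive_of_memLp {T : ℝ} (hT : 0 < T) {g : ℝ → ℝ}
    (hg : MemLp g 2 (intervalMeasure T)) :
    ContinuousOn (fun x => ∫ t in (0 : ℝ)..x, g t) (Icc 0 T) := by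
  have := ((intervalIntegrable_of_memLp hT hg).absolutelyContinuousOnInterval_intervalIntegral
    (c := 0) left_mem_uIcc).continuousOn
  rwa [uIcc_of_le hT.le] at this

/-- A function with a weak derivative `g ∈ L²(0,T)` is a primitive of `g`, up to a null set. -/
theorem HasWeakDeriv.ae_eq_primitive {T : ℝ} (hT : 0 < T) {f g : ℝ → ℝ}
    (h : HasWeakDeriv T f g) (hf : MemLp f 2 (intervalMeasure T))
    (hg : MemLp g 2 (intervalMeasure T)) :
    ∃ c : ℝ, f =ᵐ[intervalMeasure T] fun x => c + ∫ t in (0 : ℝ)..x, g t := by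
  have hgi := intervalIntegrable_of_memLp hT hg
  have hac := hgi.absolutelyContinuousOnInterval_intervalIntegral (c := 0) left_mem_uIcc
  have hcont := continuousOn_primitive_of_memLp hT hg
  set G : ℝ → ℝ := fun x => ∫ t in (0 : ℝ)..x, g t with hG
  have hGm : MemLp G 2 (intervalMeasure T) := by
    obtain ⟨C, hC⟩ := (isCompact_Icc (a := (0 : ℝ)) (b := T)).exists_bound_of_continuousOn hcont
    refine MemLp.of_bound ((hcont.mono Ioo_subset_Icc_self).aestronglyMeasurable
      measurableSet_Ioo) C ?_
    exact (ae_restrict_iff' measurableSet_Ioo).2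
      (Eventually.of_forall fun x hx => hC x (Ioo_subset_Icc_self hx))
  obtain ⟨c, hc⟩ := ae_eq_const_of_integral_mul_deriv_eq_zero hT (hf.sub hGm) (by
    intro φ hφ hφc hφs
    have hφac : AbsolutelyContinuousOnInterval φ 0 T :=
      (hφ.of_le (by exact_mod_cast le_top)).contDiffOn.absolutelyContinuousOnInterval
    have hφ0 : φ 0 = 0 := image_eq_zero_of_notMem_tsupport fun h => lt_irrefl _ (hφs h).1
    have hφT : φ T = 0 := image_eq_zero_of_notMem_tsupport fun h => lt_irrefl _ (hφs h).2
    have ibp := hac.integral_mul_deriv_eq_deriv_mul hφac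
    have hd : ∫ x in (0 : ℝ)..T, deriv G x * φ x = ∫ x in (0 : ℝ)..T, g x * φ x := by
      refine intervalIntegral.integral_congr_ae ?_
      filter_upwards [hgi.ae_hasDerivAt_integral] with x hx hm
      rw [(hx (uIoc_subset_uIcc hm) 0 left_mem_uIcc).deriv]
    rw [hd, hφ0, hφT, intervalIntegral.integral_of_le hT.le,
      intervalIntegral.integral_of_le hT.le, integral_Ioc_eq_integral_Ioo,
      integral_Ioc_eq_integral_Ioo] at ibp
    have hw := h.2.2 φ hφ hφc hφs
    have hφ' : MemLp (deriv φ) 2 (intervalMeasure T) :=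
      memLp_of_continuous T (hφ.continuous_deriv (by exact_mod_cast le_top))
    have e : ∫ t in Ioo 0 T, (f - G) t * deriv φ t =
        (∫ t in Ioo 0 T, f t * deriv φ t) - ∫ t in Ioo 0 T, G t * deriv φ t := by
      have i1 : Integrable (fun t => f t * deriv φ t) (intervalMeasure T) :=
        hf.integrable_mul hφ'
      have i2 : Integrable (fun t => G t * deriv φ t) (intervalMeasure T) :=
        hGm.integrable_mul hφ'
      rw [← integral_sub i1 i2]
      congr 1; ext t; simp only [Pi.sub_apply]; ring
    rw [e, hw, ibp]; ring)
  refine ⟨c, ?_⟩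
  filter_upwards [hc] with x hx
  rw [← hx, Pi.sub_apply]
  exact (sub_add_cancel _ _).symm

theorem HasWeakDeriv.congr_left {T : ℝ} {f f' g : ℝ → ℝ} (h : HasWeakDeriv T f g)
    (hf' : IntegrableOn f' (Ioo 0 T)) (he : f =ᵐ[intervalMeasure T] f') :
    HasWeakDeriv T f' g := by
  refine ⟨hf'.locallyIntegrableOn, h.2.1, fun φ h1 h2 h3 => ?_⟩
  rw [← h.2.2 φ h1 h2 h3]
  refine integral_congr_ae ?_
  filter_upwards [he] with t ht
  rw [ht]

theorem HasWeakDeriv.congr_right {T : ℝ} {f g g' : ℝ → ℝ} (h : HasWeakDeriv T f g)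
    (hg' : IntegrableOn g' (Ioo 0 T)) (he : g =ᵐ[intervalMeasure T] g') :
    HasWeakDeriv T f g' := by
  refine ⟨h.1, hg'.locallyIntegrableOn, fun φ h1 h2 h3 => ?_⟩
  rw [h.2.2 φ h1 h2 h3]
  congr 1
  refine integral_congr_ae ?_
  filter_upwards [he] with t ht
  rw [ht]

/-- The primitive of the second weak derivative, with the right constant, is a continuous
representative of the first. -/
theorem MemH2.exists_continuousOn_deriv {T : ℝ} (hT : 0 < T) {u : ℝ → ℝ} (hu : MemH2 T u) :
    ∃ du ddu : ℝ → ℝ, HasH2Derivs T u du ddu ∧ ContinuousOn du (Icc 0 T) := by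
  obtain ⟨du, ddu, h⟩ := hu
  obtain ⟨c, hc⟩ := h.weakDeriv2.ae_eq_primitive hT h.memLp_deriv h.memLp_deriv2
  have hm := h.memLp_deriv.ae_eq hc
  exact ⟨_, ddu, ⟨h.memLp, hm, h.memLp_deriv2,
    h.weakDeriv.congr_right (hm.integrable one_le_two) hc,
    h.weakDeriv2.congr_left (hm.integrable one_le_two) hc⟩,
    continuousOn_const.add (continuousOn_primitive_of_memLp hT h.memLp_deriv2)⟩

/-- The fundamental theorem of calculus for the continuous representative. -/
theorem HasWeakDeriv.sub_eq_integral {T : ℝ} (hT : 0 < T) {f g : ℝ → ℝ}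
    (h : HasWeakDeriv T f g) (hf : MemLp f 2 (intervalMeasure T))
    (hg : MemLp g 2 (intervalMeasure T)) (hcont : ContinuousOn f (Icc 0 T)) {a b : ℝ}
    (ha : a ∈ Icc 0 T) (hb : b ∈ Icc 0 T) : f b - f a = ∫ t in a..b, g t := by
  obtain ⟨c, hc⟩ := h.ae_eq_primitive hT hf hg
  have hgc := continuousOn_primitive_of_memLp hT hg
  have heq : EqOn f (fun x => c + ∫ t in (0 : ℝ)..x, g t) (Icc 0 T) := by
    have h1 : EqOn f (fun x => c + ∫ t in (0 : ℝ)..x, g t) (Ioo 0 T) :=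
      Measure.eqOn_open_of_ae_eq hc isOpen_Ioo (hcont.mono Ioo_subset_Icc_self)
        ((continuousOn_const.add hgc).mono Ioo_subset_Icc_self)
    exact h1.of_subset_closure hcont (continuousOn_const.add hgc) Ioo_subset_Icc_self
      (by rw [closure_Ioo hT.ne])
  have hgi := intervalIntegrable_of_memLp hT hg
  have hs : ∀ x ∈ Icc 0 T, IntervalIntegrable g volume 0 x := fun x hx =>
    hgi.mono_set (by rw [uIcc_of_le hx.1, uIcc_of_le hT.le]; exact Icc_subset_Icc_right hx.2)
  rw [heq ha, heq hb, ← intervalIntegral.integral_interval_sub_left (hs b hb) (hs a ha)]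
  ring

/-- The Cauchy-Schwarz inequality for `∫ g · 1`. -/
theorem sq_intervalIntegral_le {a b : ℝ} (hab : a ≤ b) {g : ℝ → ℝ}
    (hg : MemLp g 2 (volume.restrict (Ioc a b))) :
    (∫ t in a..b, g t) ^ 2 ≤ (b - a) * ∫ t in a..b, g t ^ 2 := by
  rw [intervalIntegral.integral_of_le hab, intervalIntegral.integral_of_le hab]
  have h1 : Integrable g (volume.restrict (Ioc a b)) := hg.integrable one_le_two
  have h2 : Integrable (fun t => g t ^ 2) (volume.restrict (Ioc a b)) := hg.integrable_sq
  rcases hab.eq_or_lt with rfl | hlt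
  · simp
  -- The integral of `(g - m)²` is nonnegative, where `m` is the mean of `g`.
  set m := (∫ t in Ioc a b, g t) / (b - a) with hm
  have h3 : 0 ≤ ∫ t in Ioc a b, (g t - m) ^ 2 := integral_nonneg fun t => sq_nonneg _
  have e : ∫ t in Ioc a b, (g t - m) ^ 2 =
      (∫ t in Ioc a b, g t ^ 2) - 2 * m * (∫ t in Ioc a b, g t) + m ^ 2 * (b - a) := by
    have : (fun t => (g t - m) ^ 2) = fun t => g t ^ 2 - 2 * m * g t + m ^ 2 := by
      ext t; ring
    have h12 : Integrable (fun t => g t ^ 2 - 2 * m * g t) (volume.restrict (Ioc a b)) :=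
      h2.sub (h1.const_mul _)
    rw [this, integral_add h12 (integrable_const _),
      integral_sub h2 (h1.const_mul _), integral_const_mul]
    simp [hab, mul_comm]
  have hpos : 0 < b - a := sub_pos.2 hlt
  have hmul : m * (b - a) = ∫ t in Ioc a b, g t := div_mul_cancel₀ _ hpos.ne'
  rw [e] at h3
  have := mul_nonneg hpos.le h3
  rw [← hmul] at this ⊢
  nlinarith

/-- The squared increments of the derivative over the mesh are controlled by the second
derivative. -/
theorem HasH2Derivs.sum_sq_sub_le {T : ℝ} (hT : 0 < T) {u du ddu : ℝ → ℝ}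
    (h : HasH2Derivs T u du ddu) (hcont : ContinuousOn du (Icc 0 T)) {n : ℕ} (hn : 1 ≤ n) :
    ∑ i ∈ Finset.range (n - 1), (du (node T n (i + 1)) - du (node T n i)) ^ 2 ≤
      meshSize T n * l2Norm T ddu ^ 2 := by
  have hn0 : (0 : ℝ) < n := by exact_mod_cast hn
  have hh : 0 < meshSize T n := div_pos hT hn0
  have hnode : ∀ i ≤ n, node T n i ∈ Icc 0 T := fun i hi => by
    refine ⟨by unfold node; positivity, ?_⟩
    have : (i : ℝ) ≤ n := by exact_mod_cast hi
    calc node T n i ≤ n * meshSize T n := by unfold node; gcongr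
      _ = T := by unfold meshSize; field_simp
  have hsucc : ∀ i, node T n (i + 1) - node T n i = meshSize T n := fun i => by
    unfold node; push_cast; ring
  have hle : ∀ i, node T n i ≤ node T n (i + 1) := fun i => by linarith [hsucc i]
  have hsqi : IntervalIntegrable (fun t => ddu t ^ 2) volume 0 T := by
    rw [intervalIntegrable_iff_integrableOn_Ioo_of_le hT.le]
    exact h.memLp_deriv2.integrable_sq
  have hIoc : MemLp ddu 2 (volume.restrict (Ioc 0 T)) := by
    rw [← restrict_Ioo_eq_restrict_Ioc]; exact h.memLp_deriv2
  have hterm : ∀ i ∈ Finset.range (n - 1),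
      (du (node T n (i + 1)) - du (node T n i)) ^ 2 ≤
        meshSize T n * ∫ t in node T n i..node T n (i + 1), ddu t ^ 2 := by
    intro i hi
    have hi := Finset.mem_range.1 hi
    rw [h.weakDeriv2.sub_eq_integral hT h.memLp_deriv h.memLp_deriv2 hcont
      (hnode i (by omega)) (hnode (i + 1) (by omega)), ← hsucc i]
    exact sq_intervalIntegral_le (hle i) (hIoc.mono_measure (Measure.restrict_mono
      (Ioc_subset_Ioc (hnode i (by omega)).1 (hnode (i + 1) (by omega)).2) le_rfl))
  have hnorm : l2Norm T ddu ^ 2 = ∫ t in (0 : ℝ)..T, ddu t ^ 2 := by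
    rw [l2Norm, h.memLp_deriv2.eLpNorm_eq_integral_rpow_norm two_ne_zero ENNReal.ofNat_ne_top,
      intervalIntegral.integral_of_le hT.le, integral_Ioc_eq_integral_Ioo]
    have hnn : 0 ≤ ∫ t in Ioo 0 T, ddu t ^ 2 := integral_nonneg fun t => sq_nonneg _
    simp only [ENNReal.toReal_ofNat, Real.rpow_ofNat, Real.norm_eq_abs, sq_abs]
    rw [ENNReal.toReal_ofReal (Real.rpow_nonneg hnn _), ← Real.rpow_natCast, ← Real.rpow_mul hnn]
    norm_num
  refine (Finset.sum_le_sum hterm).trans ?_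
  rw [← Finset.mul_sum, hnorm]
  refine mul_le_mul_of_nonneg_left ?_ hh.le
  rw [intervalIntegral.sum_integral_adjacent_intervals fun k hk =>
    hsqi.mono_set (by
      rw [uIcc_of_le (hle k), uIcc_of_le hT.le]
      exact Icc_subset_Icc (hnode k (by omega)).1 (hnode (k + 1) (by omega)).2)]
  have h0 : node T n 0 = 0 := by simp [node]
  rw [h0]
  exact intervalIntegral.integral_mono_interval le_rfl (hnode (n - 1) (by omega)).1
    (hnode (n - 1) (by omega)).2 (Eventually.of_forall fun t => sq_nonneg _) hsqi

/-! ### The Fourier symbol -/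

/-- The symbol `sin x (sin x - x cos x) / x³`: up to a factor, the product of the cosine
transform of the odd linear function on an element with the sine transform of the indicator
of an element, at half phase `x`. -/
noncomputable def modeSymbol (x : ℝ) : ℝ := Real.sin x * (Real.sin x - x * Real.cos x) / x ^ 3

/-- The part of the periodized symbol coming from the aliases `π (i + 1) ± s`,
divided by `sin s`. -/
noncomputable def aliasTerm (s : ℝ) (i : ℕ) : ℝ :=
  Real.sin s * (1 / (Real.pi * (i + 1) - s) ^ 3 + 1 / (Real.pi * (i + 1) + s) ^ 3) +
    Real.cos s * (1 / (Real.pi * (i + 1) - s) ^ 2 - 1 / (Real.pi * (i + 1) + s) ^ 2)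

theorem sub_pos_of_le_half_pi {s : ℝ} (hs : s ≤ Real.pi / 2) (i : ℕ) :
    0 < Real.pi * (i + 1) - s := by
  have : (0 : ℝ) ≤ i := i.cast_nonneg
  nlinarith [Real.pi_pos]

theorem modeSymbol_alias_add {s : ℝ} (hs0 : 0 < s) (hs : s ≤ Real.pi / 2) (i : ℕ) :
    modeSymbol (Real.pi * (i + 1) - s) + modeSymbol (Real.pi * (i + 1) + s) =
      Real.sin s * aliasTerm s i := by
  have h1 := sub_pos_of_le_half_pi hs i
  have h2 : 0 < Real.pi * (i + 1) + s := by positivity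
  have hcast : Real.pi * ((i : ℝ) + 1) = ((i + 1 : ℕ) : ℝ) * Real.pi := by push_cast; ring
  have e1 : Real.sin (Real.pi * (i + 1) - s) = -(-1) ^ (i + 1) * Real.sin s := by
    rw [hcast, Real.sin_nat_mul_pi_sub]; ring
  have e2 : Real.cos (Real.pi * (i + 1) - s) = (-1) ^ (i + 1) * Real.cos s := by
    rw [hcast, Real.cos_nat_mul_pi_sub]
  have e3 : Real.sin (Real.pi * (i + 1) + s) = (-1) ^ (i + 1) * Real.sin s := by
    rw [hcast, add_comm, Real.sin_add_nat_mul_pi]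
  have e4 : Real.cos (Real.pi * (i + 1) + s) = (-1) ^ (i + 1) * Real.cos s := by
    rw [hcast, add_comm, Real.cos_add_nat_mul_pi]
  have hsq : ((-1 : ℝ) ^ (i + 1)) ^ 2 = 1 := by rw [← pow_mul, mul_comm, pow_mul]; simp
  unfold modeSymbol aliasTerm
  rw [e1, e2, e3, e4]
  set p := Real.pi * ((i : ℝ) + 1)
  set ε := (-1 : ℝ) ^ (i + 1)
  have t1 : -ε * Real.sin s * (-ε * Real.sin s - (p - s) * (ε * Real.cos s)) =
      Real.sin s * (Real.sin s + (p - s) * Real.cos s) := by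
    linear_combination (Real.sin s * (Real.sin s + (p - s) * Real.cos s)) * hsq
  have t2 : ε * Real.sin s * (ε * Real.sin s - (p + s) * (ε * Real.cos s)) =
      Real.sin s * (Real.sin s - (p + s) * Real.cos s) := by
    linear_combination (Real.sin s * (Real.sin s - (p + s) * Real.cos s)) * hsq
  rw [t1, t2]
  field_simp
  ring

theorem aliasTerm_nonneg {s : ℝ} (hs0 : 0 < s) (hs : s ≤ Real.pi / 2) (i : ℕ) :
    0 ≤ aliasTerm s i := by
  have h1 := sub_pos_of_le_half_pi hs i
  have h2 : 0 < Real.pi * (i + 1) + s := by positivity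
  have h3 : 0 ≤ Real.sin s := Real.sin_nonneg_of_nonneg_of_le_pi hs0.le (by linarith [Real.pi_pos])
  have h4 : 0 ≤ Real.cos s := Real.cos_nonneg_of_neg_pi_div_two_le_of_le (by linarith) hs
  have h5 : 1 / (Real.pi * (i + 1) + s) ^ 2 ≤ 1 / (Real.pi * (i + 1) - s) ^ 2 := by
    gcongr; linarith
  unfold aliasTerm
  have := sub_nonneg.2 h5
  positivity

/-- Since `s ≤ π/2`, the alias `π (i+1) + s` lies to the left of `π (i+2) - s`, and the sum
telescopes. -/
theorem sum_inv_sq_sub_le {s : ℝ} (hs0 : 0 < s) (hs : s ≤ Real.pi / 2) (M : ℕ) :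
    ∑ i ∈ Finset.range M,
      (1 / (Real.pi * (i + 1) - s) ^ 2 - 1 / (Real.pi * (i + 1) + s) ^ 2) ≤
      1 / (Real.pi - s) ^ 2 - 1 / (Real.pi * (M + 1) - s) ^ 2 := by
  induction M with
  | zero => simp
  | succ M ih =>
    rw [Finset.sum_range_succ]
    have h2 : 0 < Real.pi * (M + 1) + s := by positivity
    have : 1 / (Real.pi * (((M + 1 : ℕ) : ℝ) + 1) - s) ^ 2 ≤
        1 / (Real.pi * (M + 1) + s) ^ 2 := by
      gcongr; push_cast; linarith
    linarith

/-- Comparison of an inverse cube with a telescoping difference of inverse squares. -/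
theorem inv_cube_le {y x : ℝ} (hx : 0 < x) (h : Real.pi * (x + 1 / 2) ≤ y) :
    1 / y ^ 3 ≤ (1 / x ^ 2 - 1 / (x + 1) ^ 2) / (2 * Real.pi ^ 3) := by
  have hpi := Real.pi_pos
  calc 1 / y ^ 3 ≤ 1 / (Real.pi * (x + 1 / 2)) ^ 3 := by gcongr
    _ = (1 / (x + 1 / 2) ^ 3) / Real.pi ^ 3 := by field_simp
    _ ≤ ((1 / x ^ 2 - 1 / (x + 1) ^ 2) / 2) / Real.pi ^ 3 := by
        refine div_le_div_of_nonneg_right ?_ (by positivity)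
        rw [div_sub_div _ _ (by positivity) (by positivity), div_div,
          div_le_div_iff₀ (by positivity) (by positivity)]
        nlinarith [pow_pos hx 2, pow_pos hx 3]
    _ = _ := by field_simp

theorem sum_inv_cube_le {s : ℝ} (hs0 : 0 < s) (hs : s ≤ Real.pi / 2) (M : ℕ) :
    ∑ i ∈ Finset.range (M + 1),
      (1 / (Real.pi * (i + 1) - s) ^ 3 + 1 / (Real.pi * (i + 1) + s) ^ 3) ≤
      1 / (Real.pi - s) ^ 3 + 1 / (Real.pi + s) ^ 3 +
        (1 - 1 / ((M : ℝ) + 1) ^ 2) / Real.pi ^ 3 := by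
  induction M with
  | zero => simp
  | succ M ih =>
    rw [Finset.sum_range_succ]
    have hx : (0 : ℝ) < (M : ℝ) + 1 := by positivity
    have h1 := inv_cube_le (y := Real.pi * (((M + 1 : ℕ) : ℝ) + 1) - s) hx
      (by push_cast; linarith)
    have h2 := inv_cube_le (y := Real.pi * (((M + 1 : ℕ) : ℝ) + 1) + s) hx
      (by push_cast; linarith)
    have e : (1 - 1 / (((M + 1 : ℕ) : ℝ) + 1) ^ 2) / Real.pi ^ 3 =
        (1 - 1 / ((M : ℝ) + 1) ^ 2) / Real.pi ^ 3 +
          2 * ((1 / ((M : ℝ) + 1) ^ 2 - 1 / ((M : ℝ) + 1 + 1) ^ 2) / (2 * Real.pi ^ 3)) := by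
      push_cast; field_simp; ring
    rw [e]
    linarith

/-- In terms of `v = 1 / (π - s)` the left-hand side is at most `v - (π/2) v² + v³`, which is
increasing because `π² < 12`, and `v ≤ 2/π`. -/
theorem cos_div_sq_add_le {s : ℝ} (hs : s ≤ Real.pi / 2) :
    Real.cos s / (Real.pi - s) ^ 2 + 1 / (Real.pi - s) ^ 3 ≤ 8 / Real.pi ^ 3 := by
  have hpi := Real.pi_pos
  have hy : 0 < Real.pi - s := by linarith
  have hcos : Real.cos s ≤ Real.pi / 2 - s := by
    rw [← Real.sin_pi_div_two_sub]; exact Real.sin_le (by linarith)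
  set v := 1 / (Real.pi - s) with hv
  set w := 2 / Real.pi with hw
  have hwv : v ≤ w := by
    rw [hv, hw, div_le_div_iff₀ hy hpi]; linarith
  have hpw : Real.pi / 2 * w = 1 := by rw [hw]; field_simp
  have hw0 : 0 < w := by positivity
  have e1 : Real.cos s / (Real.pi - s) ^ 2 + 1 / (Real.pi - s) ^ 3 ≤
      v - Real.pi / 2 * v ^ 2 + v ^ 3 := by
    have : v - Real.pi / 2 * v ^ 2 + v ^ 3 =
        (Real.pi / 2 - s) / (Real.pi - s) ^ 2 + 1 / (Real.pi - s) ^ 3 := by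
      rw [hv]; field_simp; ring
    rw [this]; gcongr
  have e2 : 8 / Real.pi ^ 3 = w - Real.pi / 2 * w ^ 2 + w ^ 3 := by
    rw [hw]; field_simp; ring
  have hk : Real.pi / 2 ≤ 3 * w := by
    rw [hw]
    have : Real.pi ^ 2 ≤ 12 := by nlinarith [Real.pi_lt_d2]
    rw [← mul_div_assoc, div_le_div_iff₀ two_pos hpi]; nlinarith
  have hv0 : 0 < v := by positivity
  have hquad : 0 ≤ v ^ 2 + v * w + w ^ 2 - Real.pi / 2 * v := by
    nlinarith [sq_nonneg (v - w)]
  have e3 : w - Real.pi / 2 * w ^ 2 + w ^ 3 - (v - Real.pi / 2 * v ^ 2 + v ^ 3) =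
      (w - v) * (v ^ 2 + v * w + w ^ 2 - Real.pi / 2 * v) := by
    linear_combination (-w + v) * hpw
  rw [e2]
  nlinarith [mul_nonneg (sub_nonneg.2 hwv) hquad]

/-- The bound collects `8/π³` from `cos_div_sq_add_le`, `1/π³` from `1/(π+s)³` and `1/π³` from
the cubes with `i ≥ 1`. -/
theorem sum_aliasTerm_le {s : ℝ} (hs0 : 0 < s) (hs : s ≤ Real.pi / 2) (M : ℕ) :
    ∑ i ∈ Finset.range M, aliasTerm s i ≤ 10 / Real.pi ^ 3 := by
  have hpi := Real.pi_pos
  have h3 : 0 ≤ Real.sin s := Real.sin_nonneg_of_nonneg_of_le_pi hs0.le (by linarith)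
  have h4 : 0 ≤ Real.cos s := Real.cos_nonneg_of_neg_pi_div_two_le_of_le (by linarith) hs
  have hmono : ∑ i ∈ Finset.range M, aliasTerm s i ≤
      ∑ i ∈ Finset.range (M + 1), aliasTerm s i := by
    rw [Finset.sum_range_succ]; linarith [aliasTerm_nonneg hs0 hs M]
  refine hmono.trans ?_
  unfold aliasTerm
  rw [Finset.sum_add_distrib, ← Finset.mul_sum, ← Finset.mul_sum]
  have hc := sum_inv_cube_le hs0 hs M
  have hq := sum_inv_sq_sub_le hs0 hs (M + 1)
  have hq2 := mul_le_mul_of_nonneg_left hq h4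
  have hpos : 0 ≤ ∑ i ∈ Finset.range (M + 1),
      (1 / (Real.pi * ((i : ℝ) + 1) - s) ^ 3 + 1 / (Real.pi * ((i : ℝ) + 1) + s) ^ 3) :=
    Finset.sum_nonneg fun i _ => by
      have h1 := sub_pos_of_le_half_pi hs i
      positivity
  have hc2 := mul_le_mul_of_nonneg_right (Real.sin_le_one s) hpos
  have hd := cos_div_sq_add_le hs
  have h5 : 1 / (Real.pi + s) ^ 3 ≤ 1 / Real.pi ^ 3 := by gcongr; linarith
  have h6 : (1 - 1 / ((M : ℝ) + 1) ^ 2) / Real.pi ^ 3 ≤ 1 / Real.pi ^ 3 := by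
    gcongr
    have : 0 ≤ 1 / ((M : ℝ) + 1) ^ 2 := by positivity
    linarith
  have h7 : 0 ≤ Real.cos s * (1 / (Real.pi * (((M + 1 : ℕ) : ℝ) + 1) - s) ^ 2) := by positivity
  have e : 10 / Real.pi ^ 3 = 8 / Real.pi ^ 3 + 1 / Real.pi ^ 3 + 1 / Real.pi ^ 3 := by ring
  rw [mul_sub] at hq2
  rw [div_eq_mul_one_div (Real.cos s)] at hd
  linarith

/-- Both bounds follow from `sin s - s cos s = ∫₀ˢ x sin x dx`. -/
theorem sin_sub_mul_cos_bounds {s : ℝ} (hs0 : 0 ≤ s) (hs : s ≤ Real.pi / 2) :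
    0 ≤ Real.sin s - s * Real.cos s ∧ Real.sin s - s * Real.cos s ≤ s ^ 3 / 3 := by
  have hd : ∀ x : ℝ, HasDerivAt (fun x => Real.sin x - x * Real.cos x) (x * Real.sin x) x := by
    intro x
    refine ((Real.hasDerivAt_sin x).fun_sub
      ((hasDerivAt_id' x).fun_mul (Real.hasDerivAt_cos x))).congr_deriv ?_
    ring
  have hsin : ∀ x ∈ Icc 0 s, 0 ≤ Real.sin x := fun x hx =>
    Real.sin_nonneg_of_nonneg_of_le_pi hx.1 (by linarith [hx.2, Real.pi_pos])
  have hi : ∫ x in (0 : ℝ)..s, x * Real.sin x = Real.sin s - s * Real.cos s := by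
    rw [intervalIntegral.integral_eq_sub_of_hasDerivAt (fun x _ => hd x)
      (Continuous.intervalIntegrable (by fun_prop) _ _)]
    simp
  rw [← hi]
  refine ⟨intervalIntegral.integral_nonneg hs0 fun x hx => mul_nonneg hx.1 (hsin x hx), ?_⟩
  have : ∫ x in (0 : ℝ)..s, x ^ 2 = s ^ 3 / 3 := by rw [integral_pow]; norm_num
  rw [← this]
  refine intervalIntegral.integral_mono_on hs0 (Continuous.intervalIntegrable (by fun_prop) _ _)
    (Continuous.intervalIntegrable (by fun_prop) _ _) fun x hx => ?_
  rw [sq]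
  exact mul_le_mul_of_nonneg_left (Real.sin_le hx.1) hx.1

/-- The periodized symbol is at most `√(π/6) sin s`: its zero at `s = 0` is what turns the
coefficients of `u¹` into their increments. -/
theorem sq_periodized_modeSymbol_le {s : ℝ} (hs0 : 0 < s) (hs : s ≤ Real.pi / 2) (M : ℕ) :
    (modeSymbol s + ∑ i ∈ Finset.range M,
      (modeSymbol (Real.pi * (i + 1) - s) + modeSymbol (Real.pi * (i + 1) + s))) ^ 2 ≤
      Real.pi / 6 * Real.sin s ^ 2 := by
  have hpi := Real.pi_gt_three
  obtain ⟨hb0, hb1⟩ := sin_sub_mul_cos_bounds hs0.le hs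
  have e : modeSymbol s + ∑ i ∈ Finset.range M,
      (modeSymbol (Real.pi * (i + 1) - s) + modeSymbol (Real.pi * (i + 1) + s)) =
      Real.sin s * ((Real.sin s - s * Real.cos s) / s ^ 3 +
        ∑ i ∈ Finset.range M, aliasTerm s i) := by
    rw [Finset.sum_congr rfl fun i _ => modeSymbol_alias_add hs0 hs i, ← Finset.mul_sum,
      modeSymbol]
    ring
  have h1 : 0 ≤ (Real.sin s - s * Real.cos s) / s ^ 3 := by positivity
  have h2 : (Real.sin s - s * Real.cos s) / s ^ 3 ≤ 1 / 3 := by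
    rw [div_le_iff₀ (by positivity)]; linarith
  have h3 : 0 ≤ ∑ i ∈ Finset.range M, aliasTerm s i :=
    Finset.sum_nonneg fun i _ => aliasTerm_nonneg hs0 hs i
  have h4 := sum_aliasTerm_le hs0 hs M
  -- It suffices that `1/3 + 10/27 = 19/27` and `(19/27)² ≤ 1/2 ≤ π/6`.
  have h5 : 10 / Real.pi ^ 3 ≤ 10 / 3 ^ 3 := by gcongr
  rw [e, mul_pow, mul_comm]
  refine mul_le_mul_of_nonneg_right ?_ (sq_nonneg _)
  have h6 : (Real.sin s - s * Real.cos s) / s ^ 3 + ∑ i ∈ Finset.range M, aliasTerm s i ≤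
      19 / 27 := by linarith
  nlinarith [pow_le_pow_left₀ (add_nonneg h1 h3) h6 2]

/-! ### Discrete sine and cosine transforms -/

theorem sum_cos_odd_mul (n : ℕ) (α : ℝ) :
    2 * Real.sin α * ∑ k ∈ Finset.range n, Real.cos ((2 * k + 1) * α) =
      Real.sin (2 * n * α) := by
  induction n with
  | zero => simp
  | succ n ih =>
    rw [Finset.sum_range_succ, mul_add, ih]
    have e1 : 2 * ((n + 1 : ℕ) : ℝ) * α = (2 * n + 1) * α + α := by push_cast; ring
    have e2 : 2 * (n : ℝ) * α = (2 * n + 1) * α - α := by ring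
    rw [e1, e2, Real.sin_add, Real.sin_sub]
    ring

theorem sum_cos_odd_mul_eq_zero {n : ℕ} (hn : 1 ≤ n) {p : ℤ} (hp0 : p ≠ 0)
    (hp1 : -(2 * n) < p) (hp2 : p < 2 * n) :
    ∑ k ∈ Finset.range n, Real.cos ((2 * k + 1) * (p * Real.pi / (2 * n))) = 0 := by
  have hn0 : (0 : ℝ) < n := by exact_mod_cast hn
  have hpi := Real.pi_pos
  have h := sum_cos_odd_mul n (p * Real.pi / (2 * n))
  have e : 2 * (n : ℝ) * (p * Real.pi / (2 * n)) = p * Real.pi := by field_simp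
  rw [e, Real.sin_int_mul_pi] at h
  refine (mul_eq_zero.1 h).resolve_left (mul_ne_zero two_ne_zero fun h0 => hp0 ?_)
  have hp1' : -(2 * (n : ℝ)) < p := by exact_mod_cast hp1
  have hp2' : (p : ℝ) < 2 * n := by exact_mod_cast hp2
  have hz := (Real.sin_eq_zero_iff_of_lt_of_lt (by rw [lt_div_iff₀ (by positivity)]; nlinarith)
    (by rw [div_lt_iff₀ (by positivity)]; nlinarith)).1 h0
  have : (p : ℝ) * Real.pi = 0 := (div_eq_zero_iff.1 hz).resolve_right (by positivity)
  exact_mod_cast (mul_eq_zero.1 this).resolve_right hpi.ne'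

/-- The half phase `θₖ = (2k+1)π/(4n)` of the `k`-th mode on a mesh with `n` elements. -/
noncomputable def halfPhase (n k : ℕ) : ℝ := (2 * k + 1) * Real.pi / (4 * n)

theorem halfPhase_pos {n : ℕ} (hn : 1 ≤ n) (k : ℕ) : 0 < halfPhase n k := by
  have hn0 : (0 : ℝ) < n := by exact_mod_cast hn
  have := Real.pi_pos
  unfold halfPhase; positivity

theorem halfPhase_le {n k : ℕ} (hk : k < n) : halfPhase n k ≤ Real.pi / 2 := by
  have hn0 : (0 : ℝ) < n := by exact_mod_cast (Nat.zero_le k).trans_lt hk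
  have hk' : (k : ℝ) + 1 ≤ n := by exact_mod_cast hk
  have := Real.pi_pos
  unfold halfPhase
  rw [div_le_div_iff₀ (by positivity) two_pos]
  nlinarith

theorem sum_sin_mul_sin {n : ℕ} (hn : 1 ≤ n) {i j : ℕ} (hi : i < n) (hj : j < n) :
    ∑ k ∈ Finset.range n, Real.sin ((2 * i + 1) * halfPhase n k) *
      Real.sin ((2 * j + 1) * halfPhase n k) = if i = j then (n : ℝ) / 2 else 0 := by
  have hn0 : (0 : ℝ) < n := by exact_mod_cast hn
  have e : ∀ k : ℕ, Real.sin ((2 * i + 1) * halfPhase n k) *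
      Real.sin ((2 * j + 1) * halfPhase n k) =
      (Real.cos ((2 * k + 1) * (((i - j : ℤ) : ℝ) * Real.pi / (2 * n))) -
        Real.cos ((2 * k + 1) * (((i + j + 1 : ℤ) : ℝ) * Real.pi / (2 * n)))) / 2 := by
    intro k
    have e1 : (2 * k + 1) * (((i - j : ℤ) : ℝ) * Real.pi / (2 * n)) =
        (2 * i + 1) * halfPhase n k - (2 * j + 1) * halfPhase n k := by
      unfold halfPhase; push_cast; field_simp; ring
    have e2 : (2 * k + 1) * (((i + j + 1 : ℤ) : ℝ) * Real.pi / (2 * n)) =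
        (2 * i + 1) * halfPhase n k + (2 * j + 1) * halfPhase n k := by
      unfold halfPhase; push_cast; field_simp; ring
    rw [e1, e2, Real.cos_sub, Real.cos_add]; ring
  rw [Finset.sum_congr rfl fun k _ => e k, ← Finset.sum_div, Finset.sum_sub_distrib,
    sum_cos_odd_mul_eq_zero hn (p := i + j + 1) (by omega) (by omega) (by omega)]
  split_ifs with h
  · simp [h]
  · rw [sum_cos_odd_mul_eq_zero hn (p := i - j) (by omega) (by omega) (by omega)]; simp

theorem sum_cos_mul_cos {n : ℕ} (hn : 1 ≤ n) {i j : ℕ} (hi : i < n) (hj : j < n) :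
    ∑ k ∈ Finset.range n, Real.cos (2 * i * halfPhase n k) *
      Real.cos (2 * j * halfPhase n k) =
      if i = j then (if i = 0 then (n : ℝ) else n / 2) else 0 := by
  have hn0 : (0 : ℝ) < n := by exact_mod_cast hn
  have e : ∀ k : ℕ, Real.cos (2 * i * halfPhase n k) * Real.cos (2 * j * halfPhase n k) =
      (Real.cos ((2 * k + 1) * (((i - j : ℤ) : ℝ) * Real.pi / (2 * n))) +
        Real.cos ((2 * k + 1) * (((i + j : ℤ) : ℝ) * Real.pi / (2 * n)))) / 2 := by
    intro k
    have e1 : (2 * k + 1) * (((i - j : ℤ) : ℝ) * Real.pi / (2 * n)) =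
        2 * i * halfPhase n k - 2 * j * halfPhase n k := by
      unfold halfPhase; push_cast; field_simp; ring
    have e2 : (2 * k + 1) * (((i + j : ℤ) : ℝ) * Real.pi / (2 * n)) =
        2 * i * halfPhase n k + 2 * j * halfPhase n k := by
      unfold halfPhase; push_cast; field_simp; ring
    rw [e1, e2, Real.cos_sub, Real.cos_add]; ring
  rw [Finset.sum_congr rfl fun k _ => e k, ← Finset.sum_div, Finset.sum_add_distrib]
  by_cases h : i = j
  · subst h
    by_cases h0 : i = 0
    · simp [h0]
    · rw [sum_cos_odd_mul_eq_zero hn (p := i + i) (by omega) (by omega) (by omega)]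
      simp [h0]
  · rw [sum_cos_odd_mul_eq_zero hn (p := i + j) (by omega) (by omega) (by omega),
      sum_cos_odd_mul_eq_zero hn (p := i - j) (by omega) (by omega) (by omega)]
    simp [h]

/-- Parseval's identity for a transform whose matrix `A` has orthogonal rows. -/
theorem sum_sq_transform {n : ℕ} {A : ℕ → ℕ → ℝ} {w : ℕ → ℝ}
    (hA : ∀ i < n, ∀ j < n, ∑ k ∈ Finset.range n, A i k * A j k = if i = j then w i else 0)
    (c : ℕ → ℝ) :
    ∑ k ∈ Finset.range n, (∑ i ∈ Finset.range n, c i * A i k) ^ 2 =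
      ∑ i ∈ Finset.range n, w i * c i ^ 2 := by
  simp_rw [sq, Finset.sum_mul_sum]
  rw [Finset.sum_comm]
  refine Finset.sum_congr rfl fun i hi => ?_
  rw [Finset.sum_comm]
  have hi' := Finset.mem_range.1 hi
  have : ∀ j ∈ Finset.range n, ∑ k ∈ Finset.range n, c i * A i k * (c j * A j k) =
      if i = j then w i * (c i * c i) else 0 := by
    intro j hj
    have h : ∑ k ∈ Finset.range n, c i * A i k * (c j * A j k) =
        c i * c j * ∑ k ∈ Finset.range n, A i k * A j k := by
      rw [Finset.mul_sum]; exact Finset.sum_congr rfl fun k _ => by ring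
    rw [h, hA i hi' j (Finset.mem_range.1 hj)]
    split_ifs with hij
    · subst hij; ring
    · ring
  rw [Finset.sum_congr rfl this, Finset.sum_ite_eq, if_pos hi]

/-- The discrete sine transform `ĉₖ = ∑ⱼ cⱼ sin ((2j+1)θₖ)`, where `θₖ = halfPhase n k`; it is
defined for every `k`, of which those with `k ≥ n` are aliases of those with `k < n`. -/
noncomputable def sineTransform (n : ℕ) (c : ℕ → ℝ) (k : ℕ) : ℝ :=
  ∑ j ∈ Finset.range n, c j * Real.sin ((2 * j + 1) * halfPhase n k)

theorem sum_sq_sineTransform {n : ℕ} (hn : 1 ≤ n) (c : ℕ → ℝ) :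
    ∑ k ∈ Finset.range n, sineTransform n c k ^ 2 =
      n / 2 * ∑ j ∈ Finset.range n, c j ^ 2 := by
  rw [Finset.mul_sum]
  exact sum_sq_transform (A := fun j k => Real.sin ((2 * j + 1) * halfPhase n k))
    (w := fun _ => (n : ℝ) / 2) (fun i hi j hj => sum_sin_mul_sin hn hi hj) c

/-- Summation by parts; the boundary term at the right end vanishes because
`2nθₖ` is an odd multiple of `π/2`. -/
theorem two_sin_mul_sineTransform {m k : ℕ} (c : ℕ → ℝ) :
    2 * Real.sin (halfPhase (m + 1) k) * sineTransform (m + 1) c k =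
      ∑ j ∈ Finset.range (m + 1), (if j = 0 then c 0 else c j - c (j - 1)) *
        Real.cos (2 * j * halfPhase (m + 1) k) := by
  set θ := halfPhase (m + 1) k with hθ
  have hz : Real.cos (2 * ((m : ℝ) + 1) * θ) = 0 := by
    rw [Real.cos_eq_zero_iff]
    refine ⟨k, ?_⟩
    rw [hθ, halfPhase]; push_cast; field_simp; ring
  have gen : ∀ N : ℕ, 2 * Real.sin θ * ∑ j ∈ Finset.range (N + 1),
      c j * Real.sin ((2 * j + 1) * θ) =
      (∑ j ∈ Finset.range (N + 1), (if j = 0 then c 0 else c j - c (j - 1)) *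
        Real.cos (2 * j * θ)) - c N * Real.cos (2 * ((N : ℝ) + 1) * θ) := by
    have step : ∀ j : ℕ, 2 * Real.sin θ * Real.sin ((2 * j + 1) * θ) =
        Real.cos (2 * j * θ) - Real.cos (2 * ((j : ℝ) + 1) * θ) := by
      intro j
      have e1 : 2 * (j : ℝ) * θ = (2 * j + 1) * θ - θ := by ring
      have e2 : 2 * ((j : ℝ) + 1) * θ = (2 * j + 1) * θ + θ := by ring
      rw [e1, e2, Real.cos_sub, Real.cos_add]; ring
    intro N
    induction N with
    | zero =>
      have := step 0
      simp only [zero_add, Finset.sum_range_one, if_true]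
      linear_combination c 0 * this
    | succ N ih =>
      rw [Finset.sum_range_succ, mul_add, ih, Finset.sum_range_succ _ (N + 1)]
      have := step (N + 1)
      simp only [Nat.add_eq_zero_iff, one_ne_zero, and_false, if_false, Nat.add_sub_cancel]
      push_cast at this ⊢
      linear_combination c (N + 1) * this
  rw [sineTransform, gen m, hz, mul_zero, sub_zero]

/-- Multiplication by `2 sin θₖ` turns the sine transform of `c` into the cosine transform of
the increments of `c`, with first entry `c 0`; the zeroth cosine mode has twice the squared norm
of the others, which gives the factor `2`. -/
theorem sum_sin_sq_mul_sineTransform_sq {n : ℕ} (hn : 1 ≤ n) (c : ℕ → ℝ) :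
    ∑ k ∈ Finset.range n, Real.sin (halfPhase n k) ^ 2 * sineTransform n c k ^ 2 =
      n / 8 * (2 * c 0 ^ 2 + ∑ j ∈ Finset.range (n - 1), (c (j + 1) - c j) ^ 2) := by
  obtain ⟨m, rfl⟩ : ∃ m, n = m + 1 := ⟨n - 1, by omega⟩
  have h := sum_sq_transform (n := m + 1)
    (A := fun j k => Real.cos (2 * j * halfPhase (m + 1) k))
    (w := fun j => if j = 0 then ((m + 1 : ℕ) : ℝ) else ((m + 1 : ℕ) : ℝ) / 2)
    (fun i hi j hj => sum_cos_mul_cos hn hi hj)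
    (fun j => if j = 0 then c 0 else c j - c (j - 1))
  simp only [← two_sin_mul_sineTransform] at h
  rw [Finset.sum_range_succ' (fun i => (if i = 0 then ((m + 1 : ℕ) : ℝ) else _) * _)] at h
  simp only [Nat.add_eq_zero_iff, one_ne_zero, and_false, if_false, if_true,
    Nat.add_sub_cancel, ← Finset.mul_sum] at h
  have e : ∑ k ∈ Finset.range (m + 1),
      (2 * Real.sin (halfPhase (m + 1) k) * sineTransform (m + 1) c k) ^ 2 =
      4 * ∑ k ∈ Finset.range (m + 1),
        Real.sin (halfPhase (m + 1) k) ^ 2 * sineTransform (m + 1) c k ^ 2 := by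
    rw [Finset.mul_sum]; exact Finset.sum_congr rfl fun k _ => by ring
  rw [e] at h
  rw [Nat.add_sub_cancel]
  linear_combination h / 4

/-! ### Aliasing -/

theorem halfPhase_alias_add {n : ℕ} (hn : 1 ≤ n) (m k : ℕ) :
    halfPhase n (2 * n * (m + 1) + k) = Real.pi * (m + 1) + halfPhase n k := by
  have hn0 : (0 : ℝ) < n := by exact_mod_cast hn
  unfold halfPhase; push_cast; field_simp; ring

theorem halfPhase_alias_sub {n k : ℕ} (hk : k < n) (m : ℕ) :
    halfPhase n (2 * n * (m + 1) - 1 - k) = Real.pi * (m + 1) - halfPhase n k := by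
  have hn0 : (0 : ℝ) < n := by exact_mod_cast (Nat.zero_le k).trans_lt hk
  have h : 2 * n * (m + 1) - 1 - k + (k + 1) = 2 * n * (m + 1) := by
    have : n ≤ n * (m + 1) := Nat.le_mul_of_pos_right _ (Nat.succ_pos m)
    have h2 : 2 * n * (m + 1) = 2 * (n * (m + 1)) := by ring
    omega
  have h' : ((2 * n * (m + 1) - 1 - k : ℕ) : ℝ) + (k + 1) = 2 * n * (m + 1) := by
    exact_mod_cast h
  have h'' : ((2 * n * (m + 1) - 1 - k : ℕ) : ℝ) = 2 * n * (m + 1) - (k + 1) := by linarith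
  unfold halfPhase
  rw [h'']; field_simp; ring

theorem sin_odd_mul_alias_add (j m : ℕ) (θ : ℝ) :
    Real.sin ((2 * j + 1) * (Real.pi * (m + 1) + θ)) =
      (-1) ^ (m + 1) * Real.sin ((2 * j + 1) * θ) := by
  have e : (2 * (j : ℝ) + 1) * (Real.pi * (m + 1) + θ) =
      (2 * j + 1) * θ + (((2 * j + 1) * (m + 1) : ℕ) : ℝ) * Real.pi := by push_cast; ring
  rw [e, Real.sin_add_nat_mul_pi, pow_mul, Odd.neg_one_pow ⟨j, rfl⟩]

theorem sin_odd_mul_alias_sub (j m : ℕ) (θ : ℝ) :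
    Real.sin ((2 * j + 1) * (Real.pi * (m + 1) - θ)) =
      (-1) ^ m * Real.sin ((2 * j + 1) * θ) := by
  rw [sub_eq_add_neg, sin_odd_mul_alias_add, mul_neg, Real.sin_neg]; ring

theorem sineTransform_alias_add {n : ℕ} (hn : 1 ≤ n) (c : ℕ → ℝ) (m k : ℕ) :
    sineTransform n c (2 * n * (m + 1) + k) = (-1) ^ (m + 1) * sineTransform n c k := by
  unfold sineTransform
  rw [Finset.mul_sum, halfPhase_alias_add hn]
  exact Finset.sum_congr rfl fun j _ => by rw [sin_odd_mul_alias_add]; ring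

theorem sineTransform_alias_sub {n k : ℕ} (hk : k < n) (c : ℕ → ℝ) (m : ℕ) :
    sineTransform n c (2 * n * (m + 1) - 1 - k) = (-1) ^ m * sineTransform n c k := by
  unfold sineTransform
  rw [Finset.mul_sum, halfPhase_alias_sub hk]
  exact Finset.sum_congr rfl fun j _ => by rw [sin_odd_mul_alias_sub]; ring

/-- The frequencies below `(2M+1)n`, grouped into classes of aliases. -/
theorem sum_range_alias (n M : ℕ) (f : ℕ → ℝ) :
    ∑ k ∈ Finset.range ((2 * M + 1) * n), f k =
      ∑ k ∈ Finset.range n, (f k + ∑ m ∈ Finset.range M,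
        (f (2 * n * (m + 1) - 1 - k) + f (2 * n * (m + 1) + k))) := by
  induction M with
  | zero => simp
  | succ M ih =>
    have e : (2 * (M + 1) + 1) * n = (2 * M + 1) * n + n + n := by ring
    have hblock : ∑ x ∈ Finset.range n, f ((2 * M + 1) * n + x) =
        ∑ k ∈ Finset.range n, f (2 * n * (M + 1) - 1 - k) := by
      rw [← Finset.sum_range_reflect]
      refine Finset.sum_congr rfl fun k hk => congrArg f ?_
      have hk := Finset.mem_range.1 hk
      have e1 : (2 * M + 1) * n = 2 * (n * M) + n := by ring
      have e2 : 2 * n * (M + 1) = 2 * (n * M) + n + n := by ring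
      omega
    rw [e, Finset.sum_range_add, Finset.sum_range_add, ih, hblock, add_assoc,
      ← Finset.sum_add_distrib, ← Finset.sum_add_distrib]
    refine Finset.sum_congr rfl fun k _ => ?_
    have e1 : (2 * M + 1) * n + n + k = 2 * n * (M + 1) + k := by ring
    rw [Finset.sum_range_succ, e1, add_assoc]

/-- The Cauchy-Schwarz inequality, after collecting the aliases of each of the first `n`
frequencies: these share the product of the two sine transforms. -/
theorem sq_sum_modeSymbol_le {n : ℕ} (hn : 1 ≤ n) (c d : ℕ → ℝ) (M : ℕ) :
    (∑ k ∈ Finset.range ((2 * M + 1) * n),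
      sineTransform n d k * sineTransform n c k * modeSymbol (halfPhase n k)) ^ 2 ≤
      Real.pi / 96 * n ^ 2 * (∑ j ∈ Finset.range n, c j ^ 2) *
        (2 * d 0 ^ 2 + ∑ j ∈ Finset.range (n - 1), (d (j + 1) - d j) ^ 2) := by
  set S : ℕ → ℝ := fun k => modeSymbol (halfPhase n k) + ∑ m ∈ Finset.range M,
    (modeSymbol (Real.pi * (m + 1) - halfPhase n k) +
      modeSymbol (Real.pi * (m + 1) + halfPhase n k)) with hS
  have hsum : ∑ k ∈ Finset.range ((2 * M + 1) * n),
      sineTransform n d k * sineTransform n c k * modeSymbol (halfPhase n k) =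
      ∑ k ∈ Finset.range n, (S k * sineTransform n d k) * sineTransform n c k := by
    rw [sum_range_alias]
    refine Finset.sum_congr rfl fun k hk => ?_
    have hk := Finset.mem_range.1 hk
    have hsq : ∀ m : ℕ, ((-1 : ℝ) ^ m) ^ 2 = 1 := fun m => by
      rw [← pow_mul, mul_comm, pow_mul]; simp
    have hterm : ∀ m ∈ Finset.range M,
        sineTransform n d (2 * n * (m + 1) - 1 - k) * sineTransform n c (2 * n * (m + 1) - 1 - k) *
          modeSymbol (halfPhase n (2 * n * (m + 1) - 1 - k)) +
        sineTransform n d (2 * n * (m + 1) + k) * sineTransform n c (2 * n * (m + 1) + k) *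
          modeSymbol (halfPhase n (2 * n * (m + 1) + k)) =
        sineTransform n d k * sineTransform n c k *
          (modeSymbol (Real.pi * (m + 1) - halfPhase n k) +
            modeSymbol (Real.pi * (m + 1) + halfPhase n k)) := by
      intro m _
      rw [sineTransform_alias_sub hk, sineTransform_alias_sub hk, sineTransform_alias_add hn,
        sineTransform_alias_add hn, halfPhase_alias_sub hk, halfPhase_alias_add hn]
      linear_combination (sineTransform n d k * sineTransform n c k *
        modeSymbol (Real.pi * (m + 1) - halfPhase n k)) * hsq m +
        (sineTransform n d k * sineTransform n c k *
        modeSymbol (Real.pi * (m + 1) + halfPhase n k)) * hsq (m + 1)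
    rw [Finset.sum_congr rfl hterm, ← Finset.mul_sum, hS]
    ring
  have hbound : ∑ k ∈ Finset.range n, (S k * sineTransform n d k) ^ 2 ≤
      Real.pi / 6 * (n / 8 *
        (2 * d 0 ^ 2 + ∑ j ∈ Finset.range (n - 1), (d (j + 1) - d j) ^ 2)) := by
    rw [← sum_sin_sq_mul_sineTransform_sq hn, Finset.mul_sum]
    refine Finset.sum_le_sum fun k hk => ?_
    rw [mul_pow, ← mul_assoc]
    exact mul_le_mul_of_nonneg_right (sq_periodized_modeSymbol_le (halfPhase_pos hn k)
      (halfPhase_le (Finset.mem_range.1 hk)) M) (sq_nonneg _)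
  rw [hsum]
  refine (Finset.sum_mul_sq_le_sq_mul_sq _ _ _).trans ?_
  rw [sum_sq_sineTransform hn]
  refine (mul_le_mul_of_nonneg_right hbound
    (mul_nonneg (by positivity) (Finset.sum_nonneg fun j _ => sq_nonneg _))).trans_eq ?_
  ring

/-! ### Fourier coefficients of piecewise functions -/

theorem meshSize_pos {T : ℝ} (hT : 0 < T) {n : ℕ} (hn : 1 ≤ n) : 0 < meshSize T n :=
  div_pos hT (by exact_mod_cast hn)

theorem node_succ (T : ℝ) (n i : ℕ) : node T n (i + 1) = node T n i + meshSize T n := by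
  unfold node; push_cast; ring

theorem element_subset {T : ℝ} (hT : 0 < T) {n i : ℕ} (hi : i < n) :
    element T n i ⊆ Ioo 0 T := by
  have hn0 : (0 : ℝ) < n := by exact_mod_cast (Nat.zero_le i).trans_lt hi
  have hi' : ((i + 1 : ℕ) : ℝ) ≤ n := by exact_mod_cast hi
  have hh : 0 < meshSize T n := div_pos hT hn0
  refine Ioo_subset_Ioo (by unfold node; positivity) ?_
  calc node T n (i + 1) ≤ n * meshSize T n := by unfold node; gcongr
    _ = T := by unfold meshSize; field_simp

theorem disjoint_element {T : ℝ} (hT : 0 < T) (n : ℕ) {i j : ℕ} (hij : i ≠ j) :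
    element T n i ∩ element T n j = ∅ := by
  have hh : 0 ≤ meshSize T n := div_nonneg hT.le n.cast_nonneg
  have hmono : Monotone (node T n) := fun a b hab => by
    unfold node; gcongr
  refine eq_empty_of_forall_notMem fun x hx => ?_
  rcases lt_or_gt_of_ne hij with h | h
  · exact absurd (hx.1.2.trans_le (hmono h)) (not_lt.2 hx.2.1.le)
  · exact absurd (hx.2.2.trans_le (hmono h)) (not_lt.2 hx.1.1.le)

theorem freq_eq {T : ℝ} (hT : 0 < T) {n : ℕ} (hn : 1 ≤ n) (k : ℕ) :
    freq T k = 2 * halfPhase n k / meshSize T n := by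
  have hn0 : (0 : ℝ) < n := by exact_mod_cast hn
  unfold freq halfPhase meshSize
  field_simp
  ring

theorem setIntegral_element {T : ℝ} (hT : 0 < T) {n : ℕ} (hn : 1 ≤ n) (i : ℕ) (f : ℝ → ℝ) :
    ∫ t in element T n i, f t = ∫ t in node T n i..node T n (i + 1), f t := by
  rw [intervalIntegral.integral_of_le (by rw [node_succ]; linarith [meshSize_pos hT hn]),
    integral_Ioc_eq_integral_Ioo, element]

/-- The phases of the `k`-th mode at the two ends of the `i`-th element are
`(2i+1)θₖ ∓ θₖ`, its phase at the midpoint being `(2i+1)θₖ`. -/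
theorem freq_mul_node {T : ℝ} (hT : 0 < T) {n : ℕ} (hn : 1 ≤ n) (k i : ℕ) :
    freq T k * node T n i = (2 * i + 1) * halfPhase n k - halfPhase n k := by
  have := meshSize_pos hT hn
  rw [freq_eq hT hn, node]; field_simp; ring

theorem freq_mul_node_succ {T : ℝ} (hT : 0 < T) {n : ℕ} (hn : 1 ≤ n) (k i : ℕ) :
    freq T k * node T n (i + 1) = (2 * i + 1) * halfPhase n k + halfPhase n k := by
  rw [freq_mul_node hT hn]; push_cast; ring

theorem integral_element_sin {T : ℝ} (hT : 0 < T) {n : ℕ} (hn : 1 ≤ n) (k i : ℕ) :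
    ∫ t in element T n i, Real.sin (freq T k * t) =
      meshSize T n * (Real.sin (halfPhase n k) / halfPhase n k) *
        Real.sin ((2 * i + 1) * halfPhase n k) := by
  have hh := meshSize_pos hT hn
  have hθ := halfPhase_pos hn k
  have hf : freq T k ≠ 0 := by rw [freq_eq hT hn]; positivity
  rw [setIntegral_element hT hn, intervalIntegral.integral_comp_mul_left _ hf, integral_sin,
    freq_mul_node_succ hT hn, freq_mul_node hT hn, Real.cos_sub, Real.cos_add, freq_eq hT hn,
    smul_eq_mul]
  field_simp
  ring

theorem integral_element_linear_mul_cos {T : ℝ} (hT : 0 < T) {n : ℕ} (hn : 1 ≤ n) (k i : ℕ) :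
    ∫ t in element T n i, (t - (node T n i + node T n (i + 1)) / 2) * Real.cos (freq T k * t) =
      -(meshSize T n ^ 2 / 2) * ((Real.sin (halfPhase n k) -
        halfPhase n k * Real.cos (halfPhase n k)) / halfPhase n k ^ 2) *
        Real.sin ((2 * i + 1) * halfPhase n k) := by
  have hh := meshSize_pos hT hn
  have hθ := halfPhase_pos hn k
  have hf : freq T k ≠ 0 := by rw [freq_eq hT hn]; positivity
  set μ := (node T n i + node T n (i + 1)) / 2 with hμ
  have hd : ∀ t : ℝ, HasDerivAt
      (fun t => (t - μ) * (Real.sin (freq T k * t) / freq T k) +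
        Real.cos (freq T k * t) / freq T k ^ 2)
      ((t - μ) * Real.cos (freq T k * t)) t := by
    intro t
    have h0 : HasDerivAt (fun t => freq T k * t) (freq T k) t := by
      simpa using (hasDerivAt_id' t).const_mul (freq T k)
    refine ((((hasDerivAt_id' t).sub_const μ).fun_mul (h0.sin.div_const (freq T k))).fun_add
      (h0.cos.div_const (freq T k ^ 2))).congr_deriv ?_
    field_simp
    ring
  rw [setIntegral_element hT hn, intervalIntegral.integral_eq_sub_of_hasDerivAt
    (fun t _ => hd t) (Continuous.intervalIntegrable (by fun_prop) _ _),
    freq_mul_node_succ hT hn, freq_mul_node hT hn]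
  have e1 : node T n (i + 1) - μ = meshSize T n / 2 := by rw [hμ, node_succ]; ring
  have e2 : node T n i - μ = -(meshSize T n / 2) := by rw [hμ, node_succ]; ring
  rw [e1, e2, Real.cos_sub, Real.cos_add, Real.sin_add, Real.sin_sub, freq_eq hT hn]
  field_simp
  ring

theorem inner_elementIndicator (T : ℝ) (n i : ℕ) (f : L2Space T) :
    inner ℝ (elementIndicator T n i) f = ∫ t in element T n i, f t ∂intervalMeasure T :=
  L2.inner_indicatorConstLp_one (𝕜 := ℝ) (s := element T n i) measurableSet_Ioo
    (measure_ne_top _ _) f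

theorem inner_elementIndicator_elementIndicator (T : ℝ) (n i j : ℕ) :
    inner ℝ (elementIndicator T n i) (elementIndicator T n j) =
      (intervalMeasure T).real (element T n i ∩ element T n j) :=
  L2.real_inner_indicatorConstLp_one_indicatorConstLp_one (s := element T n i)
    (t := element T n j) measurableSet_Ioo measurableSet_Ioo (measure_ne_top _ _)
    (measure_ne_top _ _)

theorem inner_sinMode_sum {T : ℝ} (hT : 0 < T) {n : ℕ} (hn : 1 ≤ n) (c : ℕ → ℝ) (k : ℕ) :
    inner ℝ (∑ i ∈ Finset.range n, c i • elementIndicator T n i) (sinMode T k) =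
      meshSize T n * (Real.sin (halfPhase n k) / halfPhase n k) * sineTransform n c k := by
  rw [sum_inner, sineTransform, Finset.mul_sum]
  refine Finset.sum_congr rfl fun i hi => ?_
  have hi := Finset.mem_range.1 hi
  rw [real_inner_smul_left, inner_elementIndicator]
  have hae := ae_restrict_of_ae (s := element T n i) ((memLp_of_continuous T
    (f := fun t => Real.sin (freq T k * t)) (by fun_prop)).coeFn_toLp)
  rw [sinMode, integral_congr_ae hae, intervalMeasure,
    Measure.restrict_restrict_of_subset (element_subset hT hi), integral_element_sin hT hn]
  ring

theorem norm_sq_sum_elementIndicator {T : ℝ} (hT : 0 < T) {n : ℕ} (hn : 1 ≤ n) (c : ℕ → ℝ) :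
    ‖∑ i ∈ Finset.range n, c i • elementIndicator T n i‖ ^ 2 =
      meshSize T n * ∑ i ∈ Finset.range n, c i ^ 2 := by
  rw [← real_inner_self_eq_norm_sq, sum_inner, Finset.mul_sum]
  refine Finset.sum_congr rfl fun i hi => ?_
  rw [inner_sum, Finset.sum_eq_single i]
  · rw [real_inner_smul_left, real_inner_smul_right, inner_elementIndicator_elementIndicator,
      inter_self, measureReal_def,
      intervalMeasure,
      Measure.restrict_apply (show MeasurableSet (element T n i) from measurableSet_Ioo),
      inter_eq_left.2 (element_subset hT (Finset.mem_range.1 hi)), element, Real.volume_Ioo,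
      node_succ, add_sub_cancel_left, ENNReal.toReal_ofReal (meshSize_pos hT hn).le]
    ring
  · intro j _ hji
    rw [real_inner_smul_left, real_inner_smul_right, inner_elementIndicator_elementIndicator,
      disjoint_element hT n hji.symm]
    simp
  · intro h; exact absurd hi h

theorem cosCoeff_u1Part {T : ℝ} (hT : 0 < T) {n : ℕ} (hn : 1 ≤ n) (du : ℝ → ℝ) (k : ℕ) :
    cosCoeff T (u1Part T n du) k =
      -(meshSize T n ^ 2 / T) * ((Real.sin (halfPhase n k) -
        halfPhase n k * Real.cos (halfPhase n k)) / halfPhase n k ^ 2) *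
        sineTransform n (fun i => du (node T n i)) k := by
  have h1 : ∫ t in Ioo 0 T, u1Part T n du t * Real.cos (freq T k * t) =
      ∫ t in Ioo 0 T, ∑ i ∈ Finset.range n, (element T n i).indicator
        (fun s => du (node T n i) * ((s - (node T n i + node T n (i + 1)) / 2) *
          Real.cos (freq T k * s))) t := by
    refine integral_congr_ae ?_
    filter_upwards [(memLp_u1Fun T n du).coeFn_toLp] with t ht
    rw [u1Part, ht, u1Fun, Finset.sum_mul]
    refine Finset.sum_congr rfl fun i _ => ?_
    by_cases hm : t ∈ element T n i
    · rw [indicator_of_mem hm, indicator_of_mem hm]; ring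
    · rw [indicator_of_notMem hm, indicator_of_notMem hm, zero_mul]
  rw [cosCoeff, h1, integral_finsetSum, sineTransform, Finset.mul_sum, Finset.mul_sum]
  · refine Finset.sum_congr rfl fun i hi => ?_
    have hm : MeasurableSet (element T n i) := measurableSet_Ioo
    rw [integral_indicator hm,
      Measure.restrict_restrict_of_subset (element_subset hT (Finset.mem_range.1 hi)),
      integral_const_mul, integral_element_linear_mul_cos hT hn]
    ring
  · intro i _
    exact ((memLp_of_continuous T (by fun_prop)).integrable one_le_two).indicator
      measurableSet_Ioo

/-! ### The estimate -/

/-- Against a piecewise constant function, the series of `𝓗_T⁻¹ u¹` has the product of two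
discrete sine transforms and the symbol as its terms. -/
theorem hasSum_inner_invModHilbert {T : ℝ} (hT : 0 < T) {n : ℕ} (hn : 1 ≤ n) (du : ℝ → ℝ)
    (c : ℕ → ℝ) :
    HasSum (fun k => -(meshSize T n ^ 3 / T) *
      (sineTransform n (fun i => du (node T n i)) k * sineTransform n c k *
        modeSymbol (halfPhase n k)))
      (inner ℝ (∑ i ∈ Finset.range n, c i • elementIndicator T n i)
        (invModHilbert T (u1Part T n du))) := by
  have h := (summable_invModHilbert T hT (u1Part T n du)).hasSum.mapL
    (innerSL ℝ (∑ i ∈ Finset.range n, c i • elementIndicator T n i))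
  refine h.congr_fun fun k => ?_
  rw [innerSL_apply_apply, real_inner_smul_right, inner_sinMode_sum hT hn, cosCoeff_u1Part hT hn,
    modeSymbol]
  have hθ := halfPhase_pos hn k
  field_simp

theorem sq_inner_invModHilbert_le {T : ℝ} (hT : 0 < T) {n : ℕ} (hn : 1 ≤ n) (du : ℝ → ℝ)
    (c : ℕ → ℝ) :
    inner ℝ (∑ i ∈ Finset.range n, c i • elementIndicator T n i)
      (invModHilbert T (u1Part T n du)) ^ 2 ≤
      Real.pi / 96 * meshSize T n ^ 3 * (2 * du (node T n 0) ^ 2 +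
        ∑ j ∈ Finset.range (n - 1), (du (node T n (j + 1)) - du (node T n j)) ^ 2) *
        ‖∑ i ∈ Finset.range n, c i • elementIndicator T n i‖ ^ 2 := by
  have hn0 : (0 : ℝ) < n := by exact_mod_cast hn
  have hsub : Tendsto (fun M : ℕ => (2 * M + 1) * n) atTop atTop :=
    tendsto_atTop_mono (fun M => by
      have : 2 * M + 1 ≤ (2 * M + 1) * n := Nat.le_mul_of_pos_right _ hn
      simp only [id]; omega) tendsto_id
  -- Partial sums of these lengths consist of complete classes of aliases.
  have ht := ((hasSum_inner_invModHilbert hT hn du c).tendsto_sum_nat.comp hsub).pow 2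
  refine le_of_tendsto' ht fun M => ?_
  simp only [Function.comp_apply]
  rw [← Finset.mul_sum, mul_pow, norm_sq_sum_elementIndicator hT hn]
  refine (mul_le_mul_of_nonneg_left (sq_sum_modeSymbol_le hn c
    (fun i => du (node T n i)) M) (sq_nonneg _)).trans_eq ?_
  unfold meshSize
  field_simp

theorem exists_eq_sum_of_mem_piecewiseConst {T : ℝ} {n : ℕ} {w : L2Space T}
    (hw : w ∈ piecewiseConst T n) :
    ∃ c : ℕ → ℝ, w = ∑ i ∈ Finset.range n, c i • elementIndicator T n i := by
  obtain ⟨c, hc⟩ := (Submodule.mem_span_range_iff_exists_fun ℝ).1 hw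
  refine ⟨fun i => if h : i < n then c ⟨i, h⟩ else 0, ?_⟩
  rw [← hc, Finset.sum_range]
  exact Finset.sum_congr rfl fun i _ => by simp

/-- The estimate of `w_h¹` through the increments of `∂ₜu` between neighbouring nodes. -/
theorem norm_sq_wh1_le {T : ℝ} (hT : 0 < T) {n : ℕ} (hn : 1 ≤ n) (du : ℝ → ℝ) :
    ‖wh1 T n du‖ ^ 2 ≤ Real.pi / 96 * meshSize T n ^ 3 * (2 * du (node T n 0) ^ 2 +
      ∑ j ∈ Finset.range (n - 1), (du (node T n (j + 1)) - du (node T n j)) ^ 2) := by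
  have hpi := Real.pi_pos
  have hh := meshSize_pos hT hn
  have hmem : wh1 T n du ∈ piecewiseConst T n := Submodule.starProjection_apply_mem _ _
  obtain ⟨c, hc⟩ := exists_eq_sum_of_mem_piecewiseConst hmem
  have hself : inner ℝ (wh1 T n du) (invModHilbert T (u1Part T n du)) = ‖wh1 T n du‖ ^ 2 := by
    rw [← real_inner_self_eq_norm_sq]
    have h := Submodule.starProjection_inner_eq_zero (K := piecewiseConst T n)
      (invModHilbert T (u1Part T n du)) _ hmem
    rw [inner_sub_left, sub_eq_zero] at h
    rw [real_inner_comm, h]; rfl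
  have hle := sq_inner_invModHilbert_le hT hn du c
  rw [← hc, hself] at hle
  have hB : 0 ≤ Real.pi / 96 * meshSize T n ^ 3 * (2 * du (node T n 0) ^ 2 +
      ∑ j ∈ Finset.range (n - 1), (du (node T n (j + 1)) - du (node T n j)) ^ 2) := by
    have : 0 ≤ ∑ j ∈ Finset.range (n - 1), (du (node T n (j + 1)) - du (node T n j)) ^ 2 :=
      Finset.sum_nonneg fun j _ => sq_nonneg _
    positivity
  -- `hle` bounds `(‖w‖²)²` by a multiple of `‖w‖²`; one factor cancels.
  rcases (sq_nonneg ‖wh1 T n du‖).eq_or_lt with h0 | h0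
  · rw [← h0]; exact hB
  · rw [sq (‖wh1 T n du‖ ^ 2)] at hle
    exact le_of_mul_le_mul_right hle h0

theorem mainTheorem5 (T : ℝ) (hT : 0 < T) (u : ℝ → ℝ) (hu : MemH2 T u) :
    (∃ du ddu : ℝ → ℝ, HasH2Derivs T u du ddu ∧ ContinuousOn du (Icc 0 T)) ∧
    ∀ du ddu : ℝ → ℝ, HasH2Derivs T u du ddu → ContinuousOn du (Icc 0 T) →
      (∀ n : ℕ, 1 ≤ n →
        ‖wh1 T n du‖ ^ 2 ≤ Real.pi / 96 * meshSize T n ^ 4 * l2Norm T ddu ^ 2 +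
          Real.pi / 48 * meshSize T n ^ 3 * du 0 ^ 2) ∧
      (du 0 = 0 →
        (∀ n : ℕ, 1 ≤ n →
          ‖wh1 T n du‖ ^ 2 ≤ Real.pi / 96 * meshSize T n ^ 4 * l2Norm T ddu ^ 2) ∧
        (fun n : ℕ => ‖wh1 T n du‖) =O[atTop] fun n : ℕ => meshSize T n ^ 2) := by
  refine ⟨hu.exists_continuousOn_deriv hT, fun du ddu h hcont => ?_⟩
  have hpi := Real.pi_pos
  have main : ∀ n : ℕ, 1 ≤ n →
      ‖wh1 T n du‖ ^ 2 ≤ Real.pi / 96 * meshSize T n ^ 4 * l2Norm T ddu ^ 2 +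
        Real.pi / 48 * meshSize T n ^ 3 * du 0 ^ 2 := by
    intro n hn
    have hh := meshSize_pos hT hn
    have h0 : node T n 0 = 0 := by simp [node]
    have h1 := norm_sq_wh1_le hT hn du
    have h2 := mul_le_mul_of_nonneg_left (h.sum_sq_sub_le hT hcont hn)
      (show 0 ≤ Real.pi / 96 * meshSize T n ^ 3 by positivity)
    rw [h0, mul_add] at h1
    linarith
  refine ⟨main, fun hz => ?_⟩
  have main0 : ∀ n : ℕ, 1 ≤ n →
      ‖wh1 T n du‖ ^ 2 ≤ Real.pi / 96 * meshSize T n ^ 4 * l2Norm T ddu ^ 2 := by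
    intro n hn
    simpa [hz] using main n hn
  refine ⟨main0, IsBigO.of_bound (l2Norm T ddu) ?_⟩
  filter_upwards [eventually_ge_atTop 1] with n hn
  have hl : 0 ≤ l2Norm T ddu := ENNReal.toReal_nonneg
  rw [norm_norm, Real.norm_of_nonneg (sq_nonneg _)]
  refine abs_le_of_sq_le_sq' ((main0 n hn).trans ?_) (by positivity) |>.2
  have h4 : Real.pi / 96 ≤ 1 := by linarith [Real.pi_le_four]
  have hx : 0 ≤ meshSize T n ^ 4 * l2Norm T ddu ^ 2 := by positivity
  nlinarith [mul_le_mul_of_nonneg_right h4 hx]
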